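/- **Types and functions.** Consider the types generated by the grammar $\mathcal T ::= \text{one-element sets} \mid \mathcal T+\mathcal T \mid \mathcal T\times\mathcal T \mid \mathcal T^*$ (disjoint union, product, finite lists). The *first-order list functions* are the smallest class of functions between such types which contains, for all types $\Sigma,\Gamma,\Delta$: all constant functions; the projections $\Sigma\times\Gamma\to\Sigma$ and $\Sigma\times\Gamma\to\Gamma$; the co-projections $\Sigma\to\Sigma+\Gamma$ and $\Gamma\to\Sigma+\Gamma$; distribution $(\Sigma+\Gamma)\times\Delta\to(\Sigma\times\Delta)+(\Gamma\times\Delta)$; reverse $\Sigma^*\to\Sigma^*$; flattening $\Sigma^{**}\to\Sigma^*$; append $\Sigma\times\Sigma^*\to\Sigma^*$, $(x_0,[x_1,\dots,x_n])\mapsto[x_0,\dots,x_n]$; co-append $\Sigma^*\to(\Sigma\times\Sigma^*)+\{\bot\}$, sending $[x_0,\dots,x_n]$ to $(x_0,[x_1,\dots,x_n])$ and $[\,]$ to $\bot$; and block $(\Sigma+\Gamma)^*\to(\Sigma^*+\Gamma^*)^*$, which groups a list into its maximal nonempty blocks over $\Sigma$ and over $\Gamma$; and which is closed under disjoint union ($f:\Sigma\to\Delta$,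 $g:\Gamma\to\Delta$ give $f+g:\Sigma+\Gamma\to\Delta$), composition, map ($f:\Sigma\to\Gamma$ gives $f^*:\Sigma^*\to\Gamma^*$) and pairing ($f:\Sigma\to\Gamma$, $g:\Sigma\to\Delta$ give $(f,g):\Sigma\to\Gamma\times\Delta$). A subset $P$ of a type $\Sigma$ is *first-order definable* if its characteristic function $\Sigma\to\{0,1\}$ is a first-order list function. For first-order definable subsets $A\subseteq\Sigma$ and $B\subseteq\Gamma$ of types, a function $A\to B$ is a *generalised first-order list function* if it is the restriction of some first-order list function $\Sigma\to\Gamma$. The *product operation* of a monoid $M$ is the map $M^*\to M$, $[m_1,\dots,m_n]\mapsto m_1\cdots m_n$ (the empty list is sent to the neutral element); if $M\subseteq\Sigma$, then $M^*$ is the set of those lists in $\Sigma^*$ all of whose entries are in $M$. **Register updates.** Let $M$ be a monoid and $k\ge 0$. A *$k$-register update* over $M$ is a $k$-tuple $\eta=(\eta_1,\dots,\eta_k)$ of words over the disjoint union $M+\{1,\dots,k\}$ (the elements of $\{1,\dots,k\}$ are the register names, and $\eta_1,\dots,\eta_k$ are the right hand sides). It is *nonduplicating* if each register name appears at most once in the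 concatenation $\eta_1\cdots\eta_k$, and *monotone* if the register names appear in $\eta_1\cdots\eta_k$ in strictly increasing order (possibly with some missing). The nonduplicating monotone $k$-register updates over $M$ form a monoid $\mathrm{Reg}(M,k)$ under composition of substitutions: $(\eta\theta)_i$ is obtained from the word $\theta_i$ by replacing every occurrence of each register name $j$ by the word $\eta_j$; the neutral element is $([1],\dots,[k])$. If $M$ is a subset of a type $\Sigma$, then $\mathrm{Reg}(M,k)$ is regarded as a subset of the type $((\Sigma+\{1,\dots,k\})^*)^k$, where for $k=0$ the type $\Sigma+\{1,\dots,k\}$ is $\Sigma$ and a $0$-th power is a one-element type. **Theorem.** Let $M$ be a monoid whose universe is a first-order definable subset of a type and whose product operation $M^*\to M$ is a generalised first-order list function. Then for every $k\in\{0,1,2,\dots\}$ the universe of $\mathrm{Reg}(M,k)$ is first-order definable and its product operation $\mathrm{Reg}(M,k)^*\to\mathrm{Reg}(M,k)$ is a generalised first-order list function. -/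

import Mathlib

/-! ### Types and first-order list functions -/

/-- Types generated from a one-element set by co-products, products and lists. -/
inductive ListTy : Type
  | one : ListTy
  | sum : ListTy → ListTy → ListTy
  | prod : ListTy → ListTy → ListTy
  | list : ListTy → ListTy

namespace ListTy

/-- The set of elements of a type. -/
@[reducible]
def El : ListTy → Type
  | one => Unit
  | sum σ τ => El σ ⊕ El τ
  | prod σ τ => El σ × El τ
  | list σ => List (El σ)

/-- The two-element type `{0, 1}`; `Sum.inl ()` is `0` and `Sum.inr ()` is `1`. -/
abbrev two : ListTy := sum one one

end ListTy

open ListTy (El)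

/-- `(Σ + Γ) × Δ → (Σ × Δ) + (Γ × Δ)`. -/
def distributeFun {α β γ : Type} : (α ⊕ β) × γ → (α × γ) ⊕ (β × γ)
  | (Sum.inl a, c) => Sum.inl (a, c)
  | (Sum.inr b, c) => Sum.inr (b, c)

/-- Splits a nonempty list into its head and its tail; the empty list is sent to `⊥`. -/
def coappendFun {α : Type} : List α → (α × List α) ⊕ Unit
  | [] => Sum.inr ()
  | a :: l => Sum.inl (a, l)

/-- Groups a list over `Σ + Γ` into its maximal nonempty blocks over `Σ` and over `Γ`. -/
def blockFun {α β : Type} : List (α ⊕ β) → List (List α ⊕ List β)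
  | [] => []
  | Sum.inl a :: l =>
    match blockFun l with
    | Sum.inl w :: r => Sum.inl (a :: w) :: r
    | r => Sum.inl [a] :: r
  | Sum.inr b :: l =>
    match blockFun l with
    | Sum.inr w :: r => Sum.inr (b :: w) :: r
    | r => Sum.inr [b] :: r

/-- The first-order list functions: the smallest class of functions between types that contains
the basic functions below and is closed under the four combinators. -/
inductive IsFOList : (σ τ : ListTy) → (El σ → El τ) → Prop
  | const (σ τ : ListTy) (c : El τ) : IsFOList σ τ (fun _ => c)
  | proj₁ (σ τ : ListTy) : IsFOList (.prod σ τ) σ (Prod.fst : El σ × El τ → El σ)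
  | proj₂ (σ τ : ListTy) : IsFOList (.prod σ τ) τ (Prod.snd : El σ × El τ → El τ)
  | coproj₁ (σ τ : ListTy) : IsFOList σ (.sum σ τ) (Sum.inl : El σ → El σ ⊕ El τ)
  | coproj₂ (σ τ : ListTy) : IsFOList τ (.sum σ τ) (Sum.inr : El τ → El σ ⊕ El τ)
  | distribute (σ τ ρ : ListTy) :
      IsFOList (.prod (.sum σ τ) ρ) (.sum (.prod σ ρ) (.prod τ ρ))
        (distributeFun : (El σ ⊕ El τ) × El ρ → (El σ × El ρ) ⊕ (El τ × El ρ))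
  | reverse (σ : ListTy) :
      IsFOList (.list σ) (.list σ) (List.reverse : List (El σ) → List (El σ))
  | flat (σ : ListTy) :
      IsFOList (.list (.list σ)) (.list σ) (List.flatten : List (List (El σ)) → List (El σ))
  | append (σ : ListTy) :
      IsFOList (.prod σ (.list σ)) (.list σ)
        (fun p : El σ × List (El σ) => (p.1 :: p.2 : List (El σ)))
  | coappend (σ : ListTy) :
      IsFOList (.list σ) (.sum (.prod σ (.list σ)) .one)
        (coappendFun : List (El σ) → (El σ × List (El σ)) ⊕ Unit)
  | block (σ τ : ListTy) :
      IsFOList (.list (.sum σ τ)) (.list (.sum (.list σ) (.list τ)))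
        (blockFun : List (El σ ⊕ El τ) → List (List (El σ) ⊕ List (El τ)))
  | disjointUnion {σ τ ρ : ListTy} {f : El σ → El ρ} {g : El τ → El ρ} :
      IsFOList σ ρ f → IsFOList τ ρ g →
      IsFOList (.sum σ τ) ρ (Sum.elim f g : El σ ⊕ El τ → El ρ)
  | comp {σ τ ρ : ListTy} {f : El σ → El τ} {g : El τ → El ρ} :
      IsFOList σ τ f → IsFOList τ ρ g → IsFOList σ ρ (fun x => g (f x))
  | map {σ τ : ListTy} {f : El σ → El τ} :
      IsFOList σ τ f →
      IsFOList (.list σ) (.list τ) (List.map f : List (El σ) → List (El τ))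
  | pairing {σ τ ρ : ListTy} {f : El σ → El τ} {g : El σ → El ρ} :
      IsFOList σ τ f → IsFOList σ ρ g →
      IsFOList σ (.prod τ ρ) (fun x => ((f x, g x) : El τ × El ρ))

/-! ### First-order definable sets and generalised first-order list functions -/

/-- A subset of a type is first-order definable if its characteristic function into `{0, 1}` is a
first-order list function. -/
def IsFODefinable {σ : ListTy} (P : Set (El σ)) : Prop :=
  ∃ χ : El σ → El ListTy.two, IsFOList σ ListTy.two χ ∧
    ∀ x : El σ, x ∈ P ↔ χ x = (Sum.inr () : Unit ⊕ Unit)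

/-- A function between first-order definable sets is a generalised first-order list function if it
is a restriction of a first-order list function. -/
def IsGenFOList {σ τ : ListTy} {A : Set (El σ)} {B : Set (El τ)} (f : A → B) : Prop :=
  IsFODefinable A ∧ IsFODefinable B ∧
    ∃ g : El σ → El τ, IsFOList σ τ g ∧ ∀ x : A, g x = f x

/-- The set `U*` of lists all of whose entries are in `U`, as a subset of the type of lists. -/
def listsOver {σ : ListTy} (U : Set (El σ)) : Set (El (.list σ)) :=
  {l : List (El σ) | ∀ x ∈ l, x ∈ U}

/-- The unbounded-arity product operation `U* → U` of a monoid with universe `U`. -/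
def monoidProduct {σ : ListTy} (U : Set (El σ)) [Monoid U] (l : listsOver U) : U :=
  (List.attachWith (l.1 : List (El σ)) (· ∈ U) l.2).prod

/-- A monoid whose universe `U` is first-order definable and whose product operation `U* → U` is a
generalised first-order list function. -/
def IsFOListMonoid {σ : ListTy} (U : Set (El σ)) [Monoid U] : Prop :=
  IsFODefinable U ∧ IsGenFOList (monoidProduct U)

/-! ### Register updates -/

/-- A `k`-register update over `M`: a `k`-tuple of words over the disjoint union of `M` and the set
of the `k` register names. -/
abbrev RegUpdate (M : Type*) (k : ℕ) := Fin k → List (M ⊕ Fin k)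

namespace RegUpdate

variable {M : Type*} {k : ℕ}

/-- The register names, in order of appearance, in the concatenation of all right hand sides. -/
def registers (η : RegUpdate M k) : List (Fin k) :=
  ((List.finRange k).flatMap η).filterMap Sum.getRight?

/-- Each register appears at most once in the concatenation of all right hand sides. -/
def Nonduplicating (η : RegUpdate M k) : Prop := η.registers.Nodup

/-- In the concatenation of all right hand sides the registers are in strictly increasing order. -/
def Monotone (η : RegUpdate M k) : Prop := η.registers.Pairwise (· < ·)

/-- The product `η θ` (first `η`, then `θ`): in the right hand sides of `θ`, every register `j` is
replaced by the `j`-th right hand side of `η`. -/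
def mul (η θ : RegUpdate M k) : RegUpdate M k :=
  fun i => (θ i).flatMap (Sum.elim (fun m => [Sum.inl m]) η)

/-- The update which leaves all registers unchanged. -/
def one : RegUpdate M k := fun i => [Sum.inr i]

theorem mul_assoc' (η θ ζ : RegUpdate M k) : (η.mul θ).mul ζ = η.mul (θ.mul ζ) := by
  funext i
  simp only [mul, List.flatMap_assoc]
  congr 1
  funext x
  cases x <;> simp [mul]

theorem one_mul' (η : RegUpdate M k) : (one : RegUpdate M k).mul η = η := by
  funext i
  have : (Sum.elim (fun m => [Sum.inl m]) one : M ⊕ Fin k → List (M ⊕ Fin k))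
      = fun x => [x] := by
    funext x
    cases x <;> simp [one]
  simp [mul, this]

theorem mul_one' (η : RegUpdate M k) : η.mul one = η := by
  funext i
  simp [mul, one]

theorem registers_eq (η : RegUpdate M k) :
    η.registers = (List.finRange k).flatMap fun i => (η i).filterMap Sum.getRight? := by
  simp [registers, List.filterMap_flatMap]

theorem registers_one : (one : RegUpdate M k).registers = List.finRange k := by
  simp [registers_eq, one]

theorem registers_mul (η θ : RegUpdate M k) :
    (η.mul θ).registers = θ.registers.flatMap fun j => (η j).filterMap Sum.getRight? := by
  rw [registers, registers]
  have : ((List.finRange k).flatMap (η.mul θ)) =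
      ((List.finRange k).flatMap θ).flatMap (Sum.elim (fun m => [Sum.inl m]) η) := by
    rw [List.flatMap_assoc]; rfl
  rw [this]
  induction (List.finRange k).flatMap θ with
  | nil => simp
  | cons x l ih => cases x <;> simp_all [List.filterMap_cons]

theorem Monotone.nonduplicating {η : RegUpdate M k} (h : η.Monotone) : η.Nonduplicating :=
  List.Pairwise.imp (fun h => ne_of_lt h) h

theorem monotone_one : (one : RegUpdate M k).Monotone := by
  rw [Monotone, registers_one]
  exact List.pairwise_lt_finRange k

theorem Monotone.mul {η θ : RegUpdate M k} (hη : η.Monotone) (hθ : θ.Monotone) :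
    (η.mul θ).Monotone := by
  rw [Monotone, registers_eq, List.pairwise_flatMap] at hη
  rw [Monotone, registers_mul, List.pairwise_flatMap]
  refine ⟨fun j _ => hη.1 j (List.mem_finRange j), hθ.imp fun {a b} hab => ?_⟩
  have h := List.pairwise_iff_getElem.1 hη.2 a b (by simp) (by simp) hab
  simpa using h

end RegUpdate

/-- The set of nonduplicating monotone `k`-register updates over `M`. -/
def RegMon (M : Type*) (k : ℕ) := {η : RegUpdate M k // η.Nonduplicating ∧ η.Monotone}

instance (M : Type*) (k : ℕ) : Monoid (RegMon M k) where
  mul η θ := ⟨η.1.mul θ.1, (η.2.2.mul θ.2.2).nonduplicating, η.2.2.mul θ.2.2⟩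
  one := ⟨RegUpdate.one, RegUpdate.monotone_one.nonduplicating, RegUpdate.monotone_one⟩
  mul_assoc _ _ _ := Subtype.ext (RegUpdate.mul_assoc' _ _ _)
  one_mul _ := Subtype.ext (RegUpdate.one_mul' _)
  mul_one _ := Subtype.ext (RegUpdate.mul_one' _)

/-! ### Register updates as elements of a type -/

/-- The type `Σ + {1, …, k}`, as the iterated co-product `1 + (1 + ⋯ (1 + Σ))`. -/
def letterTy (σ : ListTy) : ℕ → ListTy
  | 0 => σ
  | k + 1 => .sum .one (letterTy σ k)

/-- The type `Σ ^ k`, as the iterated product `Σ × (Σ × ⋯ (Σ × 1))`. -/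
def tupleTy (σ : ListTy) : ℕ → ListTy
  | 0 => .one
  | k + 1 => .prod σ (tupleTy σ k)

/-- The type of `k`-tuples of words over `Σ + {1, …, k}`. -/
def updateTy (σ : ListTy) (k : ℕ) : ListTy := tupleTy (.list (letterTy σ k)) k

/-- An element of `Σ` as an element of `Σ + {1, …, k}`. -/
def encodeElem {σ : ListTy} (x : El σ) : (k : ℕ) → El (letterTy σ k)
  | 0 => x
  | k + 1 => (Sum.inr (encodeElem x k) : Unit ⊕ El (letterTy σ k))

/-- A register name as an element of `Σ + {1, …, k}`. -/
def encodeReg (σ : ListTy) : (k : ℕ) → Fin k → El (letterTy σ k)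
  | 0 => fun i => i.elim0
  | k + 1 => fun i => (Fin.cases (Sum.inl ()) (fun j => Sum.inr (encodeReg σ k j)) i :
      Unit ⊕ El (letterTy σ k))

/-- A letter of a `k`-register update over a set `M` of elements of `Σ`, as an element of the type
`Σ + {1, …, k}`. -/
def encodeLetter {σ : ListTy} (M : Set (El σ)) (k : ℕ) : M ⊕ Fin k → El (letterTy σ k) :=
  Sum.elim (fun m => encodeElem (m : El σ) k) (encodeReg σ k)

/-- A `k`-tuple of elements of `Σ` as an element of `Σ ^ k`. -/
def encodeTuple {σ : ListTy} : (k : ℕ) → (Fin k → El σ) → El (tupleTy σ k)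
  | 0 => fun _ => ()
  | k + 1 => fun f => ((f 0, encodeTuple k fun i => f i.succ) : El σ × El (tupleTy σ k))

/-- A nonduplicating monotone `k`-register update over a set `M` of elements of `Σ`, as a `k`-tuple
of words over `Σ + {1, …, k}`. -/
def encodeUpdate {σ : ListTy} (M : Set (El σ)) (k : ℕ) (η : RegMon M k) : El (updateTy σ k) :=
  encodeTuple (σ := .list (letterTy σ k)) k fun i => (η.1 i).map (encodeLetter M k)

theorem encodeElem_injective (σ : ListTy) (k : ℕ) :
    Function.Injective fun x : El σ => encodeElem x k := by
  induction k with
  | zero => exact fun _ _ h => h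
  | succ k ih => exact fun _ _ h => ih (Sum.inr_injective h)

theorem encodeReg_injective (σ : ListTy) (k : ℕ) : Function.Injective (encodeReg σ k) := by
  induction k with
  | zero => exact fun i => i.elim0
  | succ k ih =>
    intro i j h
    induction i using Fin.cases <;> induction j using Fin.cases
    · rfl
    · exact absurd h Sum.inl_ne_inr
    · exact absurd h Sum.inr_ne_inl
    · exact congrArg Fin.succ (ih (Sum.inr_injective h))

theorem encodeElem_ne_encodeReg {σ : ListTy} (k : ℕ) (x : El σ) (i : Fin k) :
    encodeElem x k ≠ encodeReg σ k i := by
  induction k with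
  | zero => exact i.elim0
  | succ k ih =>
    intro h
    induction i using Fin.cases with
    | zero => exact absurd h Sum.inr_ne_inl
    | succ j => exact ih j (Sum.inr_injective h)

theorem encodeLetter_injective {σ : ListTy} (M : Set (El σ)) (k : ℕ) :
    Function.Injective (encodeLetter M k) := by
  rintro (a | i) (b | j) h
  · exact congrArg Sum.inl (Subtype.ext (encodeElem_injective σ k h))
  · exact absurd h (encodeElem_ne_encodeReg k _ _)
  · exact absurd h.symm (encodeElem_ne_encodeReg k _ _)
  · exact congrArg Sum.inr (encodeReg_injective σ k h)

theorem encodeTuple_injective {σ : ListTy} (k : ℕ) :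
    Function.Injective (encodeTuple (σ := σ) k) := by
  induction k with
  | zero => exact fun f g _ => funext fun i => i.elim0
  | succ k ih =>
    intro f g h
    have h' := Prod.mk.inj h
    funext i
    induction i using Fin.cases with
    | zero => exact h'.1
    | succ j => exact congrFun (ih h'.2) j

theorem encodeUpdate_injective {σ : ListTy} (M : Set (El σ)) (k : ℕ) :
    Function.Injective (encodeUpdate M k) := by
  intro η θ h
  refine Subtype.ext (funext fun i => ?_)
  exact List.map_injective_iff.2 (encodeLetter_injective M k) (congrFun (encodeTuple_injective k h) i)

/-- The nonduplicating monotone `k`-register updates over `M`, as a subset of the type of `k`-tuples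
of words over `Σ + {1, …, k}`. -/
def regMonSet {σ : ListTy} (M : Set (El σ)) (k : ℕ) : Set (El (updateTy σ k)) :=
  Set.range (encodeUpdate M k)

/-- The monoid structure on the encoded updates is that of `RegMon M k`. -/
noncomputable instance {σ : ListTy} (M : Set (El σ)) (k : ℕ) : Monoid (regMonSet M k) :=
  (Equiv.ofInjective (encodeUpdate M k) (encodeUpdate_injective M k)).symm.monoid

/-! Products are computed for substitutions with letters in all of Σ; membership of the letters in
`M` is a separate letterwise test. A word of a monotone substitution over `k` registers has at most
`k` register occurrences, hence at most `2 * k + 1` blocks. Composing two substitutions therefore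
copies the first one only boundedly often, which is first-order (`Subst.compBounded_eq`,
`FO.map_take`).

Products of long lists go by induction on `k`. Call a substitution full if each word contains
exactly its own register, and singular if some word contains no register. A monotone substitution
that is not singular is full (`Subst.Monotone.full`). In a product of full substitutions each
register only collects letters on its two sides, so the product is given by two concatenations per
register (`Subst.fullProd_eq`). A singular η factors through one register less, η = s(η) r(η) with s
= `shrink` and r = `restore`. Hence η₁⋯ηₙ = s(η₁) · [r(η₁)s(η₂)] ⋯ [r(ηₙ₋₁)s(ηₙ)] · r(ηₙ), and the
bracketed factors have one register less, so induction applies (`Subst.singularProd_eq`). A general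
list is cut in front of each singular element; every block after the first is a singular element
followed by full ones, and its product is again singular (`Subst.prodFO_eq`).

To avoid handling the combinators directly, `FO` speaks of Lean functions between types with codes,
and `fun_prop` assembles the realizers. -/

/-! ### Functions between coded types -/

/-- A type whose elements are represented by elements of a type generated by the grammar. -/
class Coded (α : Type) where
  /-- The type of the codes. -/
  ty : ListTy
  /-- The code of an element. -/
  code : α → El ty

open Coded (code)

/-- A function between coded types that is realized by a first-order list function on codes. -/
@[fun_prop]
def FO {α β : Type} [Coded α] [Coded β] (f : α → β) : Prop :=
  ∃ g, IsFOList (Coded.ty α) (Coded.ty β) g ∧ ∀ x, g (code x) = code (f x)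

instance : Coded Unit := ⟨.one, id⟩

instance {α β : Type} [Coded α] [Coded β] : Coded (α ⊕ β) :=
  ⟨.sum (Coded.ty α) (Coded.ty β), Sum.map code code⟩

instance {α β : Type} [Coded α] [Coded β] : Coded (α × β) :=
  ⟨.prod (Coded.ty α) (Coded.ty β), Prod.map code code⟩

instance {α : Type} [Coded α] : Coded (List α) :=
  ⟨.list (Coded.ty α), List.map code⟩

instance {α : Type} [Coded α] : Coded (Option α) :=
  ⟨.sum .one (Coded.ty α), fun o => o.elim (Sum.inl ()) fun a => Sum.inr (code a)⟩

instance : Coded Bool :=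
  ⟨.sum .one .one, fun b => cond b (Sum.inr ()) (Sum.inl ())⟩

/-- The type `1 + (1 + ⋯ (1 + 1))` with `n + 1` elements. -/
def finTy (n : ℕ) : ListTy := letterTy .one n

instance (n : ℕ) : Coded (Fin n) := ⟨finTy n, encodeReg .one n⟩

instance {α : Type} [Coded α] (n : ℕ) : Coded (Fin n → α) :=
  ⟨tupleTy (Coded.ty α) n, fun f => encodeTuple n fun i => code (f i)⟩

/-- The identity is not a basic function, so it is assembled separately for each constructor; on
lists it is reversal done twice. -/
theorem IsFOList.id (σ : ListTy) : IsFOList σ σ fun x => x := by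
  cases σ with
  | one => exact .const .one .one ()
  | sum σ τ =>
    convert IsFOList.disjointUnion (.coproj₁ σ τ) (.coproj₂ σ τ) using 1
    funext x; cases x <;> rfl
  | prod σ τ => exact .pairing (.proj₁ σ τ) (.proj₂ σ τ)
  | list σ =>
    convert IsFOList.comp (.reverse σ) (.reverse σ) using 1
    funext x; simp

theorem IsFOList.swap (σ τ : ListTy) : IsFOList (.prod σ τ) (.prod τ σ) fun p => (p.2, p.1) :=
  .pairing (.proj₂ σ τ) (.proj₁ σ τ)

/-! ### Closure properties of first-order functions -/

namespace FO

variable {α β γ δ : Type} [Coded α] [Coded β] [Coded γ] [Coded δ]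

@[fun_prop]
theorem id : FO fun x : α => x := ⟨_, .id _, fun _ => rfl⟩

@[fun_prop]
theorem const (b : β) : FO fun _ : α => b := ⟨_, .const _ _ (code b), fun _ => rfl⟩

@[fun_prop]
theorem comp {g : β → γ} {f : α → β} (hg : FO g) (hf : FO f) : FO fun x => g (f x) := by
  obtain ⟨f', hf', hf⟩ := hf
  obtain ⟨g', hg', hg⟩ := hg
  exact ⟨_, hf'.comp hg', fun x => by rw [hf, hg]⟩

@[fun_prop]
theorem prodMk {f : α → β} {g : α → γ} (hf : FO f) (hg : FO g) : FO fun x => (f x, g x) := by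
  obtain ⟨f', hf', hf⟩ := hf
  obtain ⟨g', hg', hg⟩ := hg
  exact ⟨_, hf'.pairing hg', fun x => by rw [hf, hg]; rfl⟩

@[fun_prop]
theorem fst : FO (Prod.fst : α × β → α) := ⟨_, .proj₁ _ _, fun _ => rfl⟩

@[fun_prop]
theorem snd : FO (Prod.snd : α × β → β) := ⟨_, .proj₂ _ _, fun _ => rfl⟩

@[fun_prop]
theorem inl : FO (Sum.inl : α → α ⊕ β) := ⟨_, .coproj₁ _ _, fun _ => rfl⟩

@[fun_prop]
theorem inr : FO (Sum.inr : β → α ⊕ β) := ⟨_, .coproj₂ _ _, fun _ => rfl⟩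

@[fun_prop]
theorem some : FO (Option.some : α → Option α) := ⟨_, .coproj₂ _ _, fun _ => rfl⟩

@[fun_prop]
theorem reverse : FO (List.reverse : List α → List α) :=
  ⟨_, .reverse _, fun _ => List.map_reverse.symm⟩

@[fun_prop]
theorem flatten : FO (List.flatten : List (List α) → List α) :=
  ⟨_, .flat _, fun _ => List.map_flatten.symm⟩

@[fun_prop]
theorem cons {f : α → β} {g : α → List β} (hf : FO f) (hg : FO g) : FO fun x => f x :: g x := by
  obtain ⟨h, hh, e⟩ := hf.prodMk hg
  refine ⟨_, hh.comp (.append _), fun x => ?_⟩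
  rw [e]; rfl

-- Here `f` cannot depend on `x`: the map combinator has no parameter. Parameters are available only
-- for lists of bounded length, through `map_take`.
@[fun_prop]
theorem map {f : β → γ} {g : α → List β} (hf : FO f) (hg : FO g) :
    FO fun x => (g x).map f := by
  obtain ⟨f', hf', hf⟩ := hf
  obtain ⟨g', hg', hg⟩ := hg
  refine ⟨_, hg'.comp hf'.map, fun x => ?_⟩
  rw [hg]
  change List.map f' (List.map code (g x)) = List.map code (List.map f (g x))
  simp [hf]

/-- Case distinction over a co-product, with a parameter. -/
@[fun_prop]
theorem sumElim {f : α → β → δ} {g : α → γ → δ} {s : α → β ⊕ γ}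
    (hf : FO fun p : α × β => f p.1 p.2) (hg : FO fun p : α × γ => g p.1 p.2) (hs : FO s) :
    FO fun x => Sum.elim (f x) (g x) (s x) := by
  obtain ⟨f', hf', hf⟩ := hf
  obtain ⟨g', hg', hg⟩ := hg
  obtain ⟨s', hs', hs⟩ := hs
  refine ⟨_, ((hs'.pairing (.id _)).comp (.distribute _ _ _)).comp
    (((IsFOList.swap _ _).comp hf').disjointUnion ((IsFOList.swap _ _).comp hg')), fun x => ?_⟩
  simp only [hs]
  rcases h : s x with b | c
  · exact hf (x, b)
  · exact hg (x, c)

@[fun_prop]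
theorem optionElim {f : α → δ} {g : α → β → δ} {s : α → Option β}
    (hf : FO f) (hg : FO fun p : α × β => g p.1 p.2) (hs : FO s) :
    FO fun x => (s x).elim (f x) (g x) := by
  obtain ⟨s', hs', hs⟩ := hs
  -- An option has the same code as the corresponding element of `Unit ⊕ β`, so `s'` realizes both.
  have h : FO fun x => Sum.elim (fun _ : Unit => f x) (g x)
      ((s x).elim (Sum.inl ()) Sum.inr) := by
    refine sumElim (f := fun x _ => f x) (hf.comp fst) hg ⟨s', hs', fun x => ?_⟩
    rw [hs]; dsimp only; cases s x <;> rfl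
  convert h using 2 with x
  cases s x <;> rfl

@[fun_prop]
theorem cond {b : α → Bool} {f g : α → β} (hb : FO b) (hf : FO f) (hg : FO g) :
    FO fun x => cond (b x) (f x) (g x) := by
  obtain ⟨b', hb', hb⟩ := hb
  have h : FO fun x => Sum.elim (fun _ : Unit => g x) (fun _ : Unit => f x)
      (Bool.rec (Sum.inl ()) (Sum.inr ()) (b x) : Unit ⊕ Unit) := by
    refine sumElim (f := fun x _ => g x) (g := fun x _ => f x) (hg.comp fst) (hf.comp fst)
      ⟨b', hb', fun x => ?_⟩
    rw [hb]; dsimp only; cases b x <;> rfl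
  convert h using 2 with x
  cases b x <;> rfl

/-- Case distinction over a finite type. -/
theorem finCases {n : ℕ} {f : α → Fin n → β} {i : α → Fin n} (hf : ∀ j, FO fun x => f x j)
    (hi : FO i) : FO fun x => f x (i x) := by
  suffices h : FO fun p : α × Fin n => f p.1 p.2 from h.comp (id.prodMk hi)
  clear hi i
  induction n with
  -- The code type of `Fin 0` is a one-element type, so the realizer needs some value there,
  -- although no element has that code. Every type of the grammar is inhabited.
  | zero => exact ⟨_, .const _ _ (Classical.choice (by
      clear f hf
      generalize Coded.ty β = τ
      induction τ with
      | one => exact ⟨()⟩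
      | sum _ _ h _ => exact h.map Sum.inl
      | prod _ _ h h' => exact ⟨h.some, h'.some⟩
      | list _ _ => exact ⟨[]⟩)), fun p => p.2.elim0⟩
  | succ n ih =>
    obtain ⟨f₀, hf₀, e₀⟩ := hf 0
    obtain ⟨f₁, hf₁, e₁⟩ := ih fun j => hf j.succ
    refine ⟨_, ((IsFOList.swap _ _).comp (.distribute .one (finTy n) _)).comp
      (((IsFOList.proj₂ _ _).comp hf₀).disjointUnion ((IsFOList.swap _ _).comp hf₁)), ?_⟩
    rintro ⟨x, j⟩
    induction j using Fin.cases with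
    | zero => exact e₀ x
    | succ j => exact e₁ (x, j)

@[fun_prop]
theorem ofFin {n : ℕ} (f : Fin n → β) : FO f :=
  finCases (f := fun _ j => f j) (fun j => const (f j)) id

@[fun_prop]
theorem apply {n : ℕ} (i : Fin n) : FO fun f : Fin n → β => f i := by
  induction n with
  | zero => exact i.elim0
  | succ n ih =>
    induction i using Fin.cases with
    | zero => exact ⟨_, .proj₁ _ _, fun _ => rfl⟩
    | succ i =>
      obtain ⟨g, hg, e⟩ := ih i
      exact ⟨_, (IsFOList.proj₂ _ _).comp hg, fun t => e fun j => t j.succ⟩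

@[fun_prop]
theorem pi {n : ℕ} {f : α → Fin n → β} (hf : ∀ i, FO fun x => f x i) : FO f := by
  induction n with
  | zero => exact ⟨_, .const _ .one (), fun _ => rfl⟩
  | succ n ih =>
    obtain ⟨f₀, hf₀, e₀⟩ := hf 0
    obtain ⟨f₁, hf₁, e₁⟩ := ih fun i => hf i.succ
    refine ⟨_, hf₀.pairing hf₁, fun x => ?_⟩
    exact Prod.ext (e₀ x) (e₁ x)

theorem apply_apply {n : ℕ} {f : α → Fin n → β} {i : α → Fin n} (hf : FO f) (hi : FO i) :
    FO fun x => f x (i x) :=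
  finCases (fun j => (apply j).comp hf) hi

end FO

/-! ### First-order list functions on lists -/

/-- The head and the tail of a list. -/
def unconsList {α : Type} : List α → Option (α × List α)
  | [] => none
  | a :: l => some (a, l)

/-- The maximal prefix of a list over a disjoint union that is over the first summand. -/
def leadingLefts {α β : Type} : List (α ⊕ β) → List α
  | Sum.inl a :: l => a :: leadingLefts l
  | _ => []

/-- The lists of elements between consecutive elements of the first summand, empty ones dropped. -/
def rightBlocks {α β : Type} (l : List (α ⊕ β)) : List (List β) :=
  (blockFun l).filterMap Sum.getRight?

/-- The pairs of consecutive elements of a list. -/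
def adjacentPairs {α : Type} : List α → List (α × α)
  | x :: y :: l => (x, y) :: adjacentPairs (y :: l)
  | _ => []

/-- Splits the list `c :: l` in front of every element of `l` that satisfies `p`. -/
def splitBefore {α : Type} (p : α → Bool) : α → List α → List (List α)
  | c, [] => [[c]]
  | c, x :: l => cond (p x) ([c] :: splitBefore p x l)
      ((unconsList (splitBefore p x l)).elim [[c]] fun b => (c :: b.1) :: b.2)

/-- The map `w.flatMap (Sum.elim f g)`, where at most `n` elements of each block over `β` and at
most `2 * n + 1` blocks are used. -/
def flatMapBounded {α β δ : Type} (n : ℕ) (f : α → List δ) (g : β → List δ) (w : List (α ⊕ β)) :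
    List δ :=
  ((blockFun w).take (2 * n + 1)).flatMap
    (Sum.elim (fun u => u.flatMap f) fun v => (v.take n).flatMap g)

/-! ### Combinatorics of blocks -/

section Blocks

variable {α β : Type}

theorem exists_blockFun_inl (a : α) (l : List (α ⊕ β)) :
    ∃ w r, blockFun (Sum.inl a :: l) = Sum.inl (a :: w) :: r := by
  rw [blockFun]; split <;> exact ⟨_, _, rfl⟩

theorem exists_blockFun_inr (b : β) (l : List (α ⊕ β)) :
    ∃ w r, blockFun (Sum.inr b :: l) = Sum.inr (b :: w) :: r := by
  rw [blockFun]; split <;> exact ⟨_, _, rfl⟩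

theorem blockFun_inl_inr (a : α) (b : β) (l : List (α ⊕ β)) :
    blockFun (Sum.inl a :: Sum.inr b :: l) = Sum.inl [a] :: blockFun (Sum.inr b :: l) := by
  obtain ⟨w, r, h⟩ := exists_blockFun_inr b l
  rw [blockFun, h]

theorem blockFun_inr_inl (a : α) (b : β) (l : List (α ⊕ β)) :
    blockFun (Sum.inr b :: Sum.inl a :: l) = Sum.inr [b] :: blockFun (Sum.inl a :: l) := by
  obtain ⟨w, r, h⟩ := exists_blockFun_inl a l
  rw [blockFun.eq_3, h]

theorem blockFun_inr_inr {b c : β} {l : List (α ⊕ β)} {w : List β} {r : List (List α ⊕ List β)}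
    (h : blockFun (Sum.inr c :: l) = Sum.inr w :: r) :
    blockFun (Sum.inr b :: Sum.inr c :: l) = Sum.inr (b :: w) :: r := by
  rw [blockFun, h]

/-- Grouping loses nothing, so letterwise operations on a word can be carried out block by block. -/
theorem flatMap_blockFun (l : List (α ⊕ β)) :
    (blockFun l).flatMap (Sum.elim (List.map Sum.inl) (List.map Sum.inr)) = l := by
  induction l with
  | nil => rfl
  | cons x l ih =>
    rcases x with a | b <;> rw [blockFun] <;> split <;> simp_all

theorem filterMap_getRight_eq (l : List (α ⊕ β)) :
    l.filterMap Sum.getRight? = (blockFun l).flatMap (Sum.elim (fun _ => []) fun v => v) := by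
  conv_lhs => rw [← flatMap_blockFun l]
  rw [List.filterMap_flatMap]
  congr 1
  funext x
  rcases x with u | v
  · induction u <;> simp_all
  · induction v <;> simp_all

/-- Blocks alternate, and each block over `β` uses up an element of `β`. The sharper bound for lists
that start in `β` is what the induction needs when a new block over `α` is put in front. -/
theorem length_blockFun_le (l : List (α ⊕ β)) :
    (blockFun l).length ≤ 2 * (l.filterMap Sum.getRight?).length + 1 ∧
      ∀ b r, l = Sum.inr b :: r →
        (blockFun l).length ≤ 2 * (l.filterMap Sum.getRight?).length := by
  induction l with
  | nil => simp [blockFun]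
  | cons x l ih =>
    rcases x with a | b
    · refine ⟨?_, by simp⟩
      rcases l with _ | ⟨a' | b, l⟩
      · simp [blockFun]
      · obtain ⟨w, r, h⟩ := exists_blockFun_inl a' l
        rw [blockFun, h]
        simpa [h, List.filterMap_cons] using ih.1
      · have := ih.2 b l rfl
        rw [blockFun_inl_inr]
        simpa [List.filterMap_cons] using this
    · suffices h : (blockFun (Sum.inr b :: l)).length ≤
          2 * ((Sum.inr b :: l).filterMap Sum.getRight?).length from ⟨by omega, fun _ _ _ => h⟩
      rw [blockFun]
      have := ih.1
      split <;> simp_all <;> omega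

/-- Under `hw` both truncations are vacuous. -/
theorem flatMapBounded_eq {δ : Type} {n : ℕ} (f : α → List δ) (g : β → List δ)
    {w : List (α ⊕ β)} (hw : (w.filterMap Sum.getRight?).length ≤ n) :
    flatMapBounded n f g w = w.flatMap (Sum.elim f g) := by
  rw [flatMapBounded, List.take_of_length_le ((length_blockFun_le w).1.trans (by omega))]
  conv_rhs => rw [← flatMap_blockFun w]
  rw [List.flatMap_assoc, List.flatMap_def, List.flatMap_def]
  congr 1
  refine List.map_congr_left fun x hx => ?_
  rcases x with u | v
  · simp [List.flatMap_map]
  · have h : v.length ≤ n := by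
      refine le_trans ?_ hw
      rw [filterMap_getRight_eq]
      exact (List.sublist_flatten_of_mem (List.mem_map_of_mem
        (f := Sum.elim (fun _ => []) fun v => v) hx)).length_le
    simp [List.flatMap_map, List.take_of_length_le h]

theorem leadingLefts_eq (w : List (α ⊕ β)) :
    leadingLefts w = ((blockFun w).head?.bind Sum.getLeft?).getD [] := by
  induction w with
  | nil => rfl
  | cons x w ih =>
    rcases x with a | b
    · rw [leadingLefts, ih, blockFun]
      split <;> rename_i h
      · simp [h]
      · rcases hw : blockFun w with _ | ⟨u | v, r⟩ <;> simp_all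
    · obtain ⟨v, r, h⟩ := exists_blockFun_inr b w
      simp [leadingLefts, h]

/-- Doubling each element around a separator turns x₁, x₂, …, xₙ into the blocks [x₁], [x₁, x₂], …,
[xₙ₋₁, xₙ], [xₙ]; the two singletons are discarded. -/
theorem adjacentPairs_eq (l : List α) :
    adjacentPairs l =
      (rightBlocks (l.flatMap fun x => [Sum.inr x, Sum.inl (), Sum.inr x])).filterMap fun b =>
        (unconsList b).elim none fun p => (unconsList p.2).elim none fun q => some (p.1, q.1) := by
  -- The leading `Sum.inr x` is the second copy of the element in front of `l`.
  have key : ∀ (x : α) (l : List α),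
      (rightBlocks (Sum.inr x :: l.flatMap fun x => [Sum.inr x, Sum.inl (), Sum.inr x])).filterMap
        (fun b => (unconsList b).elim none fun p =>
          (unconsList p.2).elim none fun q => some (p.1, q.1)) = adjacentPairs (x :: l) := by
    intro x l
    induction l generalizing x with
    | nil => rfl
    | cons y l ih =>
      rw [adjacentPairs, ← ih y, List.flatMap_cons, List.cons_append, rightBlocks, List.cons_append,
        blockFun_inr_inr (blockFun_inr_inl _ _ _)]
      simp [blockFun_inl_inr, rightBlocks, unconsList, List.filterMap_cons]
  cases l with
  | nil => rfl
  | cons x l =>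
    rw [← key, List.flatMap_cons]
    simp [blockFun_inr_inl, blockFun_inl_inr, rightBlocks, unconsList, List.filterMap_cons]

/-- A separator is put in front of each element to be cut at, and the block function does the
cutting. -/
theorem splitBefore_eq (p : α → Bool) (c : α) (l : List α) :
    splitBefore p c l = rightBlocks
      (Sum.inr c :: l.flatMap fun x => cond (p x) [Sum.inl (), Sum.inr x] [Sum.inr x]) := by
  induction l generalizing c with
  | nil => rfl
  | cons x l ih =>
    rw [splitBefore, ih, List.flatMap_cons]
    obtain ⟨w, r, h⟩ := exists_blockFun_inr x
      (l.flatMap fun x => cond (p x) [Sum.inl (), Sum.inr x] [Sum.inr x])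
    cases hx : p x
    · simp [rightBlocks, blockFun_inr_inr h, h, unconsList]
    · simp [rightBlocks, blockFun_inr_inl, blockFun_inl_inr, List.filterMap_cons]

end Blocks

/-! ### List operations that are first-order -/

namespace FO

variable {α β γ δ : Type} [Coded α] [Coded β] [Coded γ] [Coded δ]

@[fun_prop]
theorem unconsList : FO (unconsList : List α → Option (α × List α)) := by
  refine ⟨_, (IsFOList.coappend _).comp (.disjointUnion (.coproj₂ _ _) (.coproj₁ .one _)),
    fun l => ?_⟩
  cases l <;> rfl

@[fun_prop]
theorem blockFun : FO (blockFun : List (α ⊕ β) → List (List α ⊕ List β)) := by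
  refine ⟨_, .block _ _, fun l => ?_⟩
  change _root_.blockFun (List.map (Sum.map code code) l) =
    List.map (Sum.map (List.map code) (List.map code)) (_root_.blockFun l)
  induction l with
  | nil => rfl
  | cons x l ih =>
    rcases x with a | b
    all_goals
      simp only [List.map_cons, Sum.map_inl, Sum.map_inr, _root_.blockFun, ih]
      rcases _root_.blockFun l with _ | ⟨u | v, r⟩ <;> simp

@[fun_prop]
theorem append {f g : α → List β} (hf : FO f) (hg : FO g) : FO fun x => f x ++ g x := by
  have : FO fun x => [f x, g x].flatten := by fun_prop
  simpa using this

@[fun_prop]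
theorem flatMap {f : β → List γ} {g : α → List β} (hf : FO f) (hg : FO g) :
    FO fun x => (g x).flatMap f := by
  simp only [List.flatMap_def]
  fun_prop

@[fun_prop]
theorem filterMap {f : β → Option γ} {g : α → List β} (hf : FO f) (hg : FO g) :
    FO fun x => (g x).filterMap f := by
  have h : ∀ l : List β, l.filterMap f = l.flatMap fun b => (f b).elim [] fun c => [c] := by
    intro l
    induction l with
    | nil => rfl
    | cons b l ih => cases hb : f b <;> simp [hb, ih]
  simp only [h]
  fun_prop

@[fun_prop]
theorem getRight? : FO (Sum.getRight? : α ⊕ β → Option β) := by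
  have : FO fun s : α ⊕ β => Sum.elim (fun _ => none) (fun b => Option.some b) s := by fun_prop
  convert this using 2 with s
  cases s <;> rfl

@[fun_prop]
theorem getLeft? : FO (Sum.getLeft? : α ⊕ β → Option α) := by
  have : FO fun s : α ⊕ β => Sum.elim (fun a => Option.some a) (fun _ => none) s := by fun_prop
  convert this using 2 with s
  cases s <;> rfl

@[fun_prop]
theorem isEmpty : FO (List.isEmpty : List α → Bool) := by
  have : FO fun l : List α => (_root_.unconsList l).elim true fun _ => false := by fun_prop
  convert this using 2 with l
  cases l <;> rfl

@[fun_prop]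
theorem and {f g : α → Bool} (hf : FO f) (hg : FO g) : FO fun x => f x && g x := by
  have : FO fun x => bif f x then g x else false := by fun_prop
  simpa using this

@[fun_prop]
theorem all {p : β → Bool} {g : α → List β} (hp : FO p) (hg : FO g) :
    FO fun x => (g x).all p := by
  have h : ∀ l : List β,
      l.all p = (l.filterMap fun b => bif p b then none else Option.some b).isEmpty := by
    intro l
    induction l with
    | nil => rfl
    | cons b l ih => cases hb : p b <;> simp [hb, ih]
  simp only [h]
  fun_prop

@[fun_prop]
theorem head? : FO (List.head? : List α → Option α) := by
  have : FO fun l : List α => (_root_.unconsList l).elim none fun p => Option.some p.1 := by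
    fun_prop
  convert this using 2 with l
  cases l <;> rfl

@[fun_prop]
theorem getLast? : FO (List.getLast? : List α → Option α) := by
  have : FO fun l : List α => l.reverse.head? := by fun_prop
  simpa using this

/-- A list of bounded length can be mapped with a parameter. -/
theorem map_take {f : γ → α → β} (hf : FO fun p : γ × α => f p.1 p.2) (n : ℕ) :
    FO fun p : γ × List α => (p.2.take n).map (f p.1) := by
  induction n with
  | zero => simpa using const []
  | succ n ih =>
    -- Each head that is split off uses one of the `n + 1` copies of the parameter.
    have : FO fun p : γ × List α => (_root_.unconsList p.2).elim [] fun q =>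
        f p.1 q.1 :: (q.2.take n).map (f p.1) := by
      have h₁ : FO fun q : (γ × List α) × (α × List α) => f q.1.1 q.2.1 :=
        hf.comp (f := fun q : (γ × List α) × (α × List α) => (q.1.1, q.2.1)) (by fun_prop)
      have h₂ : FO fun q : (γ × List α) × (α × List α) => (q.2.2.take n).map (f q.1.1) :=
        ih.comp (f := fun q : (γ × List α) × (α × List α) => (q.1.1, q.2.2)) (by fun_prop)
      fun_prop
    convert this using 2 with p
    rcases p with ⟨c, _ | ⟨a, l⟩⟩ <;> rfl

/-- Only the blocks over `β` see the parameter, and both their number and their used length are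
bounded. The unbounded blocks over `α` are mapped without a parameter. -/
theorem flatMapBounded {n : ℕ} {f : α → List δ} {g : γ → β → List δ} {w : γ → List (α ⊕ β)}
    (hf : FO f) (hg : FO fun p : γ × β => g p.1 p.2) (hw : FO w) :
    FO fun c => flatMapBounded n f (g c) (w c) := by
  have h₁ : FO fun p : γ × List β => (p.2.take n).flatMap (g p.1) := by
    simp only [List.flatMap_def]
    exact flatten.comp (map_take hg n)
  have h₂ : FO fun p : γ × (List α ⊕ List β) =>
      Sum.elim (fun u : List α => u.flatMap f) (fun v => (v.take n).flatMap (g p.1)) p.2 := by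
    refine sumElim (f := fun _ (u : List α) => u.flatMap f) (by fun_prop) ?_ snd
    exact h₁.comp (f := fun q : (γ × (List α ⊕ List β)) × List β => (q.1.1, q.2)) (by fun_prop)
  exact flatten.comp ((map_take (f := fun c => Sum.elim (fun u : List α => u.flatMap f)
    fun v => (v.take n).flatMap (g c)) h₂ (2 * n + 1)).comp (id.prodMk (blockFun.comp hw)))

@[fun_prop]
theorem leadingLefts : FO (leadingLefts : List (α ⊕ β) → List α) := by
  have : FO fun w : List (α ⊕ β) =>
      ((_root_.blockFun w).head?.elim none Sum.getLeft?).elim [] fun u => u := by fun_prop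
  convert this using 2 with w
  rw [leadingLefts_eq]
  rcases (_root_.blockFun w).head? with _ | u | v <;> rfl

@[fun_prop]
theorem rightBlocks : FO (rightBlocks : List (α ⊕ β) → List (List β)) := by
  unfold _root_.rightBlocks
  fun_prop

@[fun_prop]
theorem adjacentPairs : FO (adjacentPairs : List α → List (α × α)) := by
  simp only [funext adjacentPairs_eq]
  fun_prop

@[fun_prop]
theorem splitBefore {p : α → Bool} {f : β → α} {g : β → List α} (hp : FO p) (hf : FO f)
    (hg : FO g) : FO fun x => splitBefore p (f x) (g x) := by
  simp only [splitBefore_eq]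
  fun_prop

end FO

/-! ### Substitutions -/

/-- An `l`-tuple of words over the disjoint union of `A` and a set of `k` register names. -/
abbrev Subst (A : Type) (k l : ℕ) := Fin l → List (A ⊕ Fin k)

/-- The register names that appear in a word. -/
def names {A ι : Type} (w : List (A ⊕ ι)) : List ι := w.filterMap Sum.getRight?

/-! ### Register names in words -/

section Names

variable {A ι κ : Type}

@[simp] theorem names_nil : names ([] : List (A ⊕ ι)) = [] := rfl

@[simp] theorem names_cons_inl (a : A) (w : List (A ⊕ ι)) : names (Sum.inl a :: w) = names w := rfl

@[simp] theorem names_cons_inr (i : ι) (w : List (A ⊕ ι)) :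
    names (Sum.inr i :: w) = i :: names w := rfl

@[simp] theorem names_append (w w' : List (A ⊕ ι)) : names (w ++ w') = names w ++ names w' :=
  List.filterMap_append

@[simp] theorem names_map_inl (u : List A) : names (u.map Sum.inl : List (A ⊕ ι)) = [] := by
  induction u <;> simp_all

theorem names_flatMap (w : List (A ⊕ ι)) (f : ι → List (A ⊕ κ)) :
    names (w.flatMap (Sum.elim (fun a => [Sum.inl a]) f)) =
      (names w).flatMap fun i => names (f i) := by
  induction w with
  | nil => rfl
  | cons x w ih => cases x <;> simp [ih]

theorem map_inl_filterMap_getLeft {w : List (A ⊕ ι)} (h : names w = []) :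
    (w.filterMap Sum.getLeft?).map Sum.inl = w := by
  induction w with
  | nil => rfl
  | cons x w ih => cases x <;> simp_all

theorem leadingLefts_append (u : List A) (i : ι) (w : List (A ⊕ ι)) :
    leadingLefts (u.map Sum.inl ++ Sum.inr i :: w) = u := by
  induction u with
  | nil => rfl
  | cons a u ih => simp [leadingLefts, ih]

theorem exists_eq_of_names_eq_singleton {w : List (A ⊕ ι)} {i : ι} (h : names w = [i]) :
    ∃ u v : List A, w = u.map Sum.inl ++ Sum.inr i :: v.map Sum.inl := by
  induction w with
  | nil => simp at h
  | cons x w ih =>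
    rcases x with a | j
    · obtain ⟨u, v, rfl⟩ := ih h
      exact ⟨a :: u, v, rfl⟩
    · simp only [names_cons_inr, List.cons.injEq] at h
      exact ⟨[], w.filterMap Sum.getLeft?, by simp [h.1, map_inl_filterMap_getLeft h.2]⟩

/-- The letters on each side of the only register are a maximal letter prefix of `w` or of its
reversal, which makes both computable by blocks. -/
theorem eq_of_names_eq_singleton {w : List (A ⊕ ι)} {i : ι} (h : names w = [i]) :
    w = (leadingLefts w).map Sum.inl ++
      Sum.inr i :: (leadingLefts w.reverse).reverse.map Sum.inl := by
  obtain ⟨u, v, rfl⟩ := exists_eq_of_names_eq_singleton h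
  have : (u.map Sum.inl ++ Sum.inr i :: v.map Sum.inl : List (A ⊕ ι)).reverse =
      v.reverse.map Sum.inl ++ Sum.inr i :: u.reverse.map Sum.inl := by simp
  rw [this, leadingLefts_append, leadingLefts_append, List.reverse_reverse]

end Names

namespace Subst

variable {A : Type} {k l m n : ℕ}

/-- The composition: in the words of `θ`, every register `j` is replaced by the word `η j`. -/
def comp (η : Subst A k l) (θ : Subst A l m) : Subst A k m :=
  fun i => (θ i).flatMap (Sum.elim (fun a => [Sum.inl a]) η)

/-- The identity substitution. -/
def one : Subst A k k := fun i => [Sum.inr i]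

/-- The register names appear in strictly increasing order in the concatenation of the words. -/
def Monotone (η : Subst A k l) : Prop :=
  (∀ i, (names (η i)).Pairwise (· < ·)) ∧
    ∀ i j, i < j → ∀ x ∈ names (η i), ∀ y ∈ names (η j), x < y

/-- The product of a list of substitutions. -/
def prod (L : List (Subst A k k)) : Subst A k k := L.foldr comp one

theorem comp_assoc (η : Subst A k l) (θ : Subst A l m) (ζ : Subst A m n) :
    (η.comp θ).comp ζ = η.comp (θ.comp ζ) := by
  funext i
  simp only [comp, List.flatMap_assoc]
  congr 1
  funext x
  cases x <;> simp [comp]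

@[simp] theorem comp_one (η : Subst A k l) : η.comp one = η := by
  funext i
  simp [comp, one]

@[simp] theorem one_comp (η : Subst A k l) : one.comp η = η := by
  funext i
  have : (Sum.elim (fun a => [Sum.inl a]) one : A ⊕ Fin k → List (A ⊕ Fin k)) =
      fun x => [x] := by
    funext x
    cases x <;> simp [one]
  simp [comp, this]

@[simp] theorem prod_nil : prod ([] : List (Subst A k k)) = one := rfl

@[simp] theorem prod_cons (η : Subst A k k) (L : List (Subst A k k)) :
    prod (η :: L) = η.comp (prod L) := rfl

theorem prod_append (L L' : List (Subst A k k)) :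
    prod (L ++ L') = (prod L).comp (prod L') := by
  induction L with
  | nil => simp
  | cons η L ih => simp [ih, comp_assoc]

theorem prod_flatten (L : List (List (Subst A k k))) : prod L.flatten = prod (L.map prod) := by
  induction L with
  | nil => rfl
  | cons η L ih => simp [ih, prod_append]

theorem names_comp (η : Subst A k l) (θ : Subst A l m) (i : Fin m) :
    names (η.comp θ i) = (names (θ i)).flatMap fun j => names (η j) :=
  names_flatMap _ _

theorem monotone_one : (one : Subst A k k).Monotone := by
  refine ⟨fun i => by simp [one], fun i j h => ?_⟩
  simpa [one] using h

theorem Monotone.comp {η : Subst A k l} {θ : Subst A l m} (hη : η.Monotone) (hθ : θ.Monotone) :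
    (η.comp θ).Monotone := by
  refine ⟨fun i => ?_, fun i j h x hx y hy => ?_⟩
  · rw [names_comp, List.pairwise_flatMap]
    exact ⟨fun j _ => hη.1 j, (hθ.1 i).imp fun {a b} hab => hη.2 a b hab⟩
  · rw [names_comp, List.mem_flatMap] at hx hy
    obtain ⟨a, ha, hx⟩ := hx
    obtain ⟨b, hb, hy⟩ := hy
    exact hη.2 a b (hθ.2 i j h a ha b hb) x hx y hy

theorem monotone_prod {L : List (Subst A k k)} (h : ∀ η ∈ L, η.Monotone) : (prod L).Monotone := by
  induction L with
  | nil => exact monotone_one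
  | cons η L ih => exact (h η (by simp)).comp (ih fun θ hθ => h θ (by simp [hθ]))

/-- A first-order version of `Subst.comp`, which is correct for monotone substitutions. -/
def compBounded (η : Subst A k l) (θ : Subst A l m) : Subst A k m :=
  fun i => flatMapBounded l (fun a => [Sum.inl a]) η (θ i)

/-- A word of `θ` repeats no register, so it has at most `l` register occurrences; `η` may be
arbitrary. -/
theorem compBounded_eq (η : Subst A k l) {θ : Subst A l m} (hθ : θ.Monotone) :
    η.compBounded θ = η.comp θ := by
  funext i
  refine flatMapBounded_eq _ _ ?_
  have : (names (θ i)).Nodup := (hθ.1 i).imp ne_of_lt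
  simpa [names] using this.length_le_card

/-- The first register of the target whose word contains no register. -/
def emptyIndex (η : Subst A k l) : Option (Fin l) :=
  (List.finRange l).find? fun i => (names (η i)).isEmpty

/-- Every word contains exactly its own register. -/
def Full (η : Subst A k k) : Prop := ∀ i, names (η i) = [i]

theorem Full.comp {η θ : Subst A k k} (hη : η.Full) (hθ : θ.Full) : (η.comp θ).Full := by
  intro i
  simp [names_comp, hη _, hθ _]

theorem full_one : (one : Subst A k k).Full := fun _ => rfl

theorem full_prod {L : List (Subst A k k)} (h : ∀ η ∈ L, η.Full) : (prod L).Full := by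
  induction L with
  | nil => exact full_one
  | cons η L ih => exact (h η (by simp)).comp (ih fun θ hθ => h θ (by simp [hθ]))

theorem Monotone.full {η : Subst A k k} (hη : η.Monotone) (h : η.emptyIndex = none) : η.Full := by
  have hne : ∀ i, ∃ x, x ∈ names (η i) := by
    intro i
    rw [emptyIndex, List.find?_eq_none] at h
    have := h i (List.mem_finRange i)
    exact List.exists_mem_of_ne_nil _ (by simpa using this)
  -- Any choice of one register per word is strictly increasing, hence an order automorphism of `Fin
  -- k`, hence the identity.
  have key : ∀ r : Fin k → Fin k, (∀ i, r i ∈ names (η i)) → ∀ i, r i = i := by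
    intro r hr i
    have hm : StrictMono r := fun i j hij => hη.2 i j hij _ (hr i) _ (hr j)
    have := Subsingleton.elim (hm.orderIsoOfSurjective r
      (Finite.surjective_of_injective hm.injective)) (OrderIso.refl _)
    exact DFunLike.congr_fun this i
  choose r hr using hne
  intro i
  have hall : ∀ x ∈ names (η i), x = i := by
    intro x hx
    -- Any register `x` of the `i`-th word may serve as the choice at `i`.
    have := key (Function.update r i x) (fun j => by
      rcases eq_or_ne j i with rfl | hj
      · simpa using hx
      · simpa [hj] using hr j) i
    simpa using this
  have hnd : (names (η i)).Nodup := (hη.1 i).imp ne_of_lt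
  have hi := hr i
  rw [hall _ hi] at hi
  exact List.perm_singleton.1 ((List.perm_ext_iff_of_nodup hnd (by simp)).2 fun x =>
    ⟨fun hx => by simp [hall x hx], fun hx => by simp_all⟩)

/-- The product of a list of full substitutions, computed separately for each register. -/
def fullProd (L : List (Subst A k k)) : Subst A k k := fun i =>
  (L.reverse.flatMap fun η => (leadingLefts (η i)).map Sum.inl) ++
    Sum.inr i :: L.flatMap fun η => (leadingLefts (η i).reverse).reverse.map Sum.inl

/-- Composing with a new first factor replaces the register `i` by u i v, so its letters land next
to the register, inside those of the later factors. This is why the left parts appear in reversed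
order. -/
theorem fullProd_eq {L : List (Subst A k k)} (h : ∀ η ∈ L, η.Full) : fullProd L = prod L := by
  induction L with
  | nil => rfl
  | cons η L ih =>
    rw [prod_cons, ← ih fun θ hθ => h θ (by simp [hθ])]
    funext i
    have hη := eq_of_names_eq_singleton (h η (by simp) i)
    have aux : ∀ (L : List (Subst A k k)) (f : Subst A k k → List A),
        (L.flatMap fun θ => (f θ).map Sum.inl).flatMap
          (Sum.elim (fun a => [Sum.inl a]) η) = L.flatMap fun θ => (f θ).map Sum.inl := by
      intro L f
      simp [List.flatMap_assoc, List.map_eq_flatMap]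
    simp only [comp, fullProd, List.flatMap_append, List.flatMap_cons, Sum.elim_inr]
    rw [aux, aux L fun θ => (leadingLefts (θ i).reverse).reverse]
    conv_rhs => rw [hη]
    simp

/-- Leaves out the `i`-th word. -/
def dropAt (i : Fin (l + 1)) (η : Subst A k (l + 1)) : Subst A k l := fun j => η (i.succAbove j)

/-- Inserts the letters of `w` as the word of a new register `i`. -/
def insertAt (i : Fin (k + 1)) (w : List (A ⊕ Fin m)) : Subst A k (k + 1) :=
  Fin.insertNth (α := fun _ => List (A ⊕ Fin k)) i ((w.filterMap Sum.getLeft?).map Sum.inl)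
    fun j => [Sum.inr j]

theorem Monotone.dropAt {η : Subst A k (l + 1)} (hη : η.Monotone) (i : Fin (l + 1)) :
    (dropAt i η).Monotone :=
  ⟨fun _ => hη.1 _, fun _ _ h => hη.2 _ _ (Fin.strictMono_succAbove i h)⟩

theorem monotone_insertAt (i : Fin (k + 1)) (w : List (A ⊕ Fin m)) :
    (insertAt i w : Subst A k (k + 1)).Monotone := by
  refine ⟨fun j => ?_, fun j j' h => ?_⟩
  · induction j using Fin.succAboveCases i <;> simp [insertAt]
  · induction j using Fin.succAboveCases i
    · simp [insertAt]
    · induction j' using Fin.succAboveCases i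
      · simp [insertAt]
      · simpa [insertAt] using h

/-- A word without registers does not depend on the input, so it can be written afterwards by the
second factor. -/
theorem dropAt_comp_insertAt {η : Subst A k (l + 1)} {i : Fin (l + 1)} (h : names (η i) = []) :
    (dropAt i η).comp (insertAt i (η i)) = η := by
  funext j
  induction j using Fin.succAboveCases i
  · conv_rhs => rw [← map_inl_filterMap_getLeft h]
    simp [comp, insertAt, List.flatMap_map, ← List.map_eq_flatMap]
  · simp [comp, insertAt, dropAt]

/-- The part of a singular substitution that goes through one register less. -/
def shrink (η : Subst A k (l + 1)) : Subst A k l := dropAt (η.emptyIndex.getD 0) η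

/-- The part of a singular substitution that restores the register without registers in its
word. -/
def restore (η : Subst A k (l + 1)) : Subst A l (l + 1) :=
  insertAt (η.emptyIndex.getD 0) (η (η.emptyIndex.getD 0))

theorem Monotone.shrink {η : Subst A k (l + 1)} (hη : η.Monotone) : η.shrink.Monotone :=
  hη.dropAt _

theorem monotone_restore (η : Subst A k (l + 1)) : η.restore.Monotone := monotone_insertAt _ _

/-- Under `h` the default index `0` is not used, and the dropped word really has no register. -/
theorem shrink_comp_restore {η : Subst A k (l + 1)} (h : η.emptyIndex.isSome) :
    η.shrink.comp η.restore = η := by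
  obtain ⟨i, hi⟩ := Option.isSome_iff_exists.1 h
  refine dropAt_comp_insertAt ?_
  rw [hi]
  simpa using List.find?_some hi

/-- Since `θ` is full, the `i`-th word of the composite has the same registers as that of `η`. -/
theorem isSome_emptyIndex_comp {η θ : Subst A k k} (h : η.emptyIndex.isSome) (hθ : θ.Full) :
    (η.comp θ).emptyIndex.isSome := by
  simpa [emptyIndex, names_comp, hθ _] using h

/-- The product of a list of singular substitutions, given the product for one register less. -/
def singularProd (P : List (Subst A k k) → Subst A k k) (L : List (Subst A (k + 1) (k + 1))) :
    Subst A (k + 1) (k + 1) :=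
  L.head?.elim one fun η => L.getLast?.elim one fun θ =>
    η.shrink.compBounded
      ((P ((adjacentPairs L).map fun p => p.1.restore.compBounded p.2.shrink)).compBounded
        θ.restore)

theorem singularProd_eq {P : List (Subst A k k) → Subst A k k}
    (hP : ∀ L, (∀ η ∈ L, η.Monotone) → P L = prod L) {L : List (Subst A (k + 1) (k + 1))}
    (hL : ∀ η ∈ L, η.Monotone) (hL' : ∀ η ∈ L, η.emptyIndex.isSome) :
    singularProd P L = prod L := by
  -- Monotonicity of the middle factors is carried along: it is what allows `hP`, and the
  -- replacement of `compBounded` by `comp`.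
  have key : ∀ (L : List (Subst A (k + 1) (k + 1))) (η : Subst A (k + 1) (k + 1)),
      (∀ θ ∈ η :: L, θ.Monotone) → (∀ θ ∈ η :: L, θ.emptyIndex.isSome) →
      (∀ θ ∈ (adjacentPairs (η :: L)).map fun p => p.1.restore.compBounded p.2.shrink,
        θ.Monotone) ∧ ∃ θ, (η :: L).getLast? = some θ ∧
        η.shrink.comp ((prod ((adjacentPairs (η :: L)).map
          fun p => p.1.restore.compBounded p.2.shrink)).comp θ.restore) = prod (η :: L) := by
    intro L
    induction L with
    | nil =>
      intro η _ h
      exact ⟨by simp [adjacentPairs], η, rfl,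
        by simp [adjacentPairs, shrink_comp_restore (h η (by simp))]⟩
    | cons ζ L ih =>
      intro η hm hs
      obtain ⟨h₁, θ, h₂, h₃⟩ := ih ζ (fun θ h => hm θ (List.mem_cons_of_mem _ h))
        (fun θ h => hs θ (List.mem_cons_of_mem _ h))
      have hζ : ζ.shrink.Monotone := (hm ζ (by simp)).shrink
      refine ⟨?_, θ, by simpa using h₂, ?_⟩
      · rw [adjacentPairs, List.map_cons, List.forall_mem_cons]
        refine ⟨?_, h₁⟩
        rw [compBounded_eq _ hζ]
        exact (monotone_restore η).comp hζ
      · rw [adjacentPairs, List.map_cons, prod_cons, prod_cons, ← h₃, compBounded_eq _ hζ]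
        conv_rhs => rw [← shrink_comp_restore (hs η (by simp))]
        simp only [comp_assoc]
  cases L with
  | nil => rfl
  | cons η L =>
    obtain ⟨h₁, θ, h₂, h₃⟩ := key L η hL hL'
    rw [singularProd, h₂, ← h₃, hP _ h₁]
    simp only [List.head?_cons, Option.elim_some]
    rw [compBounded_eq _ (monotone_restore θ),
      compBounded_eq _ ((monotone_prod h₁).comp (monotone_restore θ))]

end Subst

theorem exists_splitBefore_eq {α : Type} (p : α → Bool) (c : α) (l : List α) :
    ∃ f r, splitBefore p c l = (c :: f) :: r ∧ f ++ r.flatten = l ∧ (∀ x ∈ f, p x = false) ∧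
      ∀ b ∈ r, ∃ x g, b = x :: g ∧ p x = true ∧ ∀ y ∈ g, p y = false := by
  induction l generalizing c with
  | nil => exact ⟨[], [], by simp [splitBefore]⟩
  | cons x l ih =>
    obtain ⟨f, r, h, rfl, hf, hr⟩ := ih x
    cases hx : p x
    · exact ⟨x :: f, r, by simp [splitBefore, hx, h, unconsList], by simp, by simp_all, hr⟩
    · refine ⟨[], (x :: f) :: r, by simp [splitBefore, hx, h], by simp, by simp, ?_⟩
      rw [List.forall_mem_cons]
      exact ⟨⟨x, f, rfl, hx, hf⟩, hr⟩

namespace Subst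

variable {A : Type} {k l m n : ℕ}

/-- The product of a list whose elements except possibly the first one are full. -/
def blockProd (L : List (Subst A k k)) : Subst A k k :=
  (unconsList L).elim one fun p => p.1.compBounded (fullProd p.2)

/-- A first-order version of `Subst.prod`, which is correct for monotone substitutions. -/
def prodFO : (k : ℕ) → List (Subst A k k) → Subst A k k
  | 0, _ => one
  | k + 1, L =>
    (unconsList ((splitBefore (fun η => η.emptyIndex.isSome) one L).map blockProd)).elim one
      fun p => p.1.compBounded (singularProd (prodFO k) p.2)

theorem blockProd_cons {η : Subst A k k} {L : List (Subst A k k)} (h : ∀ θ ∈ L, θ.Monotone)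
    (h' : ∀ θ ∈ L, θ.emptyIndex.isSome = false) : blockProd (η :: L) = prod (η :: L) := by
  have hL : ∀ θ ∈ L, θ.Full := fun θ hθ => (h θ hθ).full (by simpa using h' θ hθ)
  rw [blockProd, unconsList, Option.elim_some, fullProd_eq hL,
    compBounded_eq _ (monotone_prod h), prod_cons]

/-- The neutral element put in front makes the first block nonempty and treats the full elements
before the first singular one; all later blocks have singular products. -/
theorem prodFO_eq {L : List (Subst A k k)} (hL : ∀ η ∈ L, η.Monotone) : prodFO k L = prod L := by
  induction k with
  | zero => exact funext fun i => i.elim0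
  | succ k ih =>
    obtain ⟨f, r, h, rfl, hf, hr⟩ :=
      exists_splitBefore_eq (fun η : Subst A (k + 1) (k + 1) => η.emptyIndex.isSome) one L
    have hr' : r.map blockProd = r.map prod := by
      refine List.map_congr_left fun b hb => ?_
      obtain ⟨η, g, rfl, hη, hg⟩ := hr b hb
      exact blockProd_cons (fun θ hθ => hL θ (by simp; exact Or.inr ⟨_, hb, by simp [hθ]⟩)) hg
    have hm : ∀ η ∈ r.map prod, η.Monotone := by
      simp only [List.mem_map]
      rintro _ ⟨b, hb, rfl⟩
      exact monotone_prod fun θ hθ => hL θ (by simp; exact Or.inr ⟨_, hb, hθ⟩)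
    rw [prodFO, h, List.map_cons, hr', unconsList, Option.elim_some,
      blockProd_cons (fun θ hθ => hL θ (by simp [hθ])) hf, singularProd_eq (fun _ => ih) hm,
      compBounded_eq _ (monotone_prod hm), prod_append, prod_flatten, prod_cons, one_comp]
    simp only [List.mem_map]
    rintro _ ⟨b, hb, rfl⟩
    obtain ⟨η, g, rfl, hη, hg⟩ := hr b hb
    refine isSome_emptyIndex_comp hη (full_prod fun θ hθ => ?_)
    exact (hL θ (by simp; exact Or.inr ⟨_, hb, by simp [hθ]⟩)).full (by simpa using hg θ hθ)

end Subst

/-! ### Products of substitutions as first-order list functions -/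

namespace FO

variable {α β γ δ A ι : Type} [Coded α] [Coded β] [Coded γ] [Coded δ] [Coded A] [Coded ι]
  {k l m n : ℕ}

@[fun_prop]
theorem names : FO (names : List (A ⊕ ι) → List ι) := by
  unfold _root_.names
  fun_prop

@[fun_prop]
theorem isSome : FO (Option.isSome : Option α → Bool) := by
  have : FO fun o : Option α => o.elim false fun _ => true := by fun_prop
  convert this using 2 with o
  cases o <;> rfl

/-- The list `L` is fixed, so the search unrolls into finitely many case distinctions. -/
theorem find? {p : β → α → Bool} {L : List β} (hp : ∀ i, FO (p i)) :
    FO fun x => L.find? fun i => p i x := by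
  induction L with
  | nil => simpa using const none
  | cons i L ih =>
    have hi := hp i
    have : FO fun x => bif p i x then Option.some i else L.find? fun i => p i x := by fun_prop
    convert this using 2 with x
    cases h : p i x <;> simp [h]

@[fun_prop]
theorem emptyIndex : FO (Subst.emptyIndex : Subst A k l → Option (Fin l)) :=
  find? fun i => by fun_prop

@[fun_prop]
theorem compBounded {f : α → Subst A k l} {g : α → Subst A l m} (hf : FO f) (hg : FO g) :
    FO fun x => (f x).compBounded (g x) := by
  refine pi fun i => ?_
  refine flatMapBounded (by fun_prop) ?_ (by fun_prop)
  exact apply_apply (by fun_prop) (by fun_prop)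

@[fun_prop]
theorem fullProd : FO (Subst.fullProd : List (Subst A k k) → Subst A k k) := by
  unfold Subst.fullProd
  fun_prop

@[fun_prop]
theorem index : FO fun η : Subst A k (l + 1) => η.emptyIndex.getD 0 := by
  have : FO fun η : Subst A k (l + 1) => η.emptyIndex.elim 0 fun i => i := by fun_prop
  convert this using 2 with η
  cases η.emptyIndex <;> rfl

@[fun_prop]
theorem dropAt (i : Fin (l + 1)) : FO (Subst.dropAt i : Subst A k (l + 1) → Subst A k l) := by
  unfold Subst.dropAt
  fun_prop

@[fun_prop]
theorem insertAt (i : Fin (k + 1)) :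
    FO fun w : List (A ⊕ Fin m) => (Subst.insertAt i w : Subst A k (k + 1)) := by
  refine pi fun j => ?_
  induction j using Fin.succAboveCases i
  · simp only [Subst.insertAt, Fin.insertNth_apply_same]
    fun_prop
  · simp only [Subst.insertAt, Fin.insertNth_apply_succAbove]
    fun_prop

-- The position depends on `η` but ranges over a finite set, so each position is treated separately.
@[fun_prop]
theorem shrink : FO (Subst.shrink : Subst A k (l + 1) → Subst A k l) :=
  finCases (f := fun η i => Subst.dropAt i η) (fun i => by fun_prop) index

@[fun_prop]
theorem restore : FO (Subst.restore : Subst A k (l + 1) → Subst A l (l + 1)) :=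
  finCases (f := fun η i => Subst.insertAt i (η i)) (fun i => by fun_prop) index

theorem singularProd {P : List (Subst A k k) → Subst A k k} (hP : FO P) :
    FO (Subst.singularProd P) := by
  unfold Subst.singularProd
  fun_prop

@[fun_prop]
theorem blockProd : FO (Subst.blockProd : List (Subst A k k) → Subst A k k) := by
  unfold Subst.blockProd
  fun_prop

theorem prodFO (k : ℕ) : FO (Subst.prodFO k : List (Subst A k k) → Subst A k k) := by
  induction k with
  | zero => exact const Subst.one
  | succ k ih =>
    have := singularProd ih
    change FO fun L => Subst.prodFO (k + 1) L
    simp only [Subst.prodFO]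
    fun_prop

end FO

/-! ### Elements of a type, coded by themselves -/

/-- The set of elements of `σ`, where every element is its own code. -/
def Carrier (σ : ListTy) : Type := El σ

/-- As `Carrier` is not reducible, `Carrier (.list σ)` keeps this identity code; `Carrier.toList`
passes to the entrywise coding of lists. -/
instance (σ : ListTy) : Coded (Carrier σ) := ⟨σ, fun x => x⟩

section Carrier

variable {σ τ ρ : ListTy}

theorem fo_iff_isFOList {f : Carrier σ → Carrier τ} : FO f ↔ IsFOList σ τ f :=
  ⟨fun ⟨g, hg, h⟩ => (funext h : g = f) ▸ hg, fun h => ⟨f, h, fun _ => rfl⟩⟩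

/-- The elements of the type of lists, as lists of elements. -/
def Carrier.toList (l : Carrier (.list σ)) : List (Carrier σ) := l

/-- Lists of elements, as elements of the type of lists. -/
def Carrier.ofList (l : List (Carrier σ)) : Carrier (.list σ) := l

@[fun_prop]
theorem FO.toList : FO (Carrier.toList : Carrier (.list σ) → List (Carrier σ)) :=
  ⟨_, .id _, fun l => (List.map_id (α := El σ) l).symm⟩

@[fun_prop]
theorem FO.ofList : FO (Carrier.ofList : List (Carrier σ) → Carrier (.list σ)) :=
  ⟨_, .id _, fun l => List.map_id (α := El σ) l⟩

theorem FO.isFOList_list {f : List (Carrier σ) → Carrier τ} (hf : FO f) :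
    IsFOList (.list σ) τ f :=
  fo_iff_isFOList.1 (hf.comp FO.toList)

theorem isFODefinable_iff {P : Set (El σ)} :
    IsFODefinable P ↔ ∃ p : Carrier σ → Bool, FO p ∧ ∀ x : El σ, x ∈ P ↔ p x = true := by
  constructor
  · rintro ⟨χ, hχ, h⟩
    refine ⟨fun x => Sum.elim (fun _ => false) (fun _ => true) (χ x), ⟨χ, hχ, fun x => ?_⟩,
      fun x => (h x).trans ?_⟩
    · dsimp only
      change χ x = _
      rcases χ x with _ | _ <;> rfl
    · dsimp only
      generalize χ x = y
      rcases y with _ | _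
      · exact ⟨fun h => absurd h Sum.inl_ne_inr, fun h => absurd h Bool.false_ne_true⟩
      · exact ⟨fun _ => rfl, fun _ => rfl⟩
  · rintro ⟨p, ⟨χ, hχ, h⟩, hp⟩
    refine ⟨χ, hχ, fun x => (hp x).trans ?_⟩
    have := h x
    change χ x = _ at this
    rw [this]
    cases p x
    · exact ⟨fun h => absurd h (by simp), fun h => absurd h Sum.inl_ne_inr⟩
    · exact ⟨fun _ => rfl, fun _ => rfl⟩

theorem IsFODefinable.listsOver {U : Set (El σ)} (hU : IsFODefinable U) :
    IsFODefinable (listsOver U) := by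
  obtain ⟨p, hp, h⟩ := isFODefinable_iff.1 hU
  refine isFODefinable_iff.2 ⟨fun l => l.toList.all p, by fun_prop, fun l => ?_⟩
  rw [List.all_eq_true]
  exact forall₂_congr fun x _ => h x

/-- The inverse of `encodeLetter Set.univ`. -/
def decodeLetter : (k : ℕ) → Carrier (letterTy σ k) → Carrier σ ⊕ Fin k
  | 0, x => Sum.inl x
  | k + 1, x => Sum.elim (fun _ => Sum.inr 0)
      (fun y => Sum.elim Sum.inl (fun i => Sum.inr i.succ) (decodeLetter k y))
      (show Unit ⊕ Carrier (letterTy σ k) from x)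

/-- An element of `Σ` as an element of `Σ + {1, …, k}`. -/
def elemCode (k : ℕ) (x : Carrier σ) : Carrier (letterTy σ k) := encodeElem (σ := σ) x k

/-- A register name as an element of `Σ + {1, …, k}`. -/
def regCode (σ : ListTy) (k : ℕ) (i : Fin k) : Carrier (letterTy σ k) := encodeReg σ k i

/-- A letter over `Σ` as an element of `Σ + {1, …, k}`. -/
def letterCode (k : ℕ) (x : Carrier σ ⊕ Fin k) : Carrier (letterTy σ k) :=
  Sum.elim (elemCode k) (regCode σ k) x

/-- A tuple as an element of the type of tuples. -/
def tupleCode {k : ℕ} (f : Fin k → Carrier σ) : Carrier (tupleTy σ k) := encodeTuple (σ := σ) k f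

/-- The components of a tuple. -/
def decodeTuple : (k : ℕ) → Carrier (tupleTy σ k) → Fin k → Carrier σ
  | 0, _ => fun i => i.elim0
  | k + 1, x => Fin.cons (α := fun _ => Carrier σ) (x : El σ × El (tupleTy σ k)).1
      (decodeTuple k (x : El σ × El (tupleTy σ k)).2)

/-- The substitution that is coded by an element of the type of tuples of words. -/
def decodeSubst {k : ℕ} (x : Carrier (updateTy σ k)) : Subst (Carrier σ) k k :=
  fun i => (decodeTuple k x i).toList.map (decodeLetter k)

/-- A substitution as an element of the type of tuples of words. -/
def encodeSubst {k : ℕ} (η : Subst (Carrier σ) k k) : Carrier (updateTy σ k) :=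
  tupleCode (σ := .list (letterTy σ k)) fun i => Carrier.ofList ((η i).map (letterCode k))

@[simp]
theorem decodeLetter_letterCode (k : ℕ) (x : Carrier σ ⊕ Fin k) :
    decodeLetter k (letterCode k x) = x := by
  induction k with
  | zero => rcases x with a | i; exacts [rfl, i.elim0]
  | succ k ih =>
    rcases x with a | i
    · exact congrArg (Sum.elim Sum.inl fun i => Sum.inr i.succ) (ih (Sum.inl a))
    · induction i using Fin.cases with
      | zero => rfl
      | succ i => exact congrArg (Sum.elim Sum.inl fun i => Sum.inr i.succ) (ih (Sum.inr i))

@[simp]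
theorem letterCode_decodeLetter (k : ℕ) (x : Carrier (letterTy σ k)) :
    letterCode k (decodeLetter k x) = x := by
  induction k with
  | zero => rfl
  | succ k ih =>
    rcases (show Unit ⊕ Carrier (letterTy σ k) from x) with _ | y
    · rfl
    · have h := ih y
      change letterCode (k + 1)
        (Sum.elim Sum.inl (fun i => Sum.inr i.succ) (decodeLetter k y)) = Sum.inr y
      rcases h' : decodeLetter k y with a | i <;> rw [h'] at h <;> exact congrArg Sum.inr h

@[simp]
theorem decodeTuple_tupleCode {k : ℕ} (f : Fin k → Carrier σ) :
    decodeTuple k (tupleCode f) = f := by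
  induction k with
  | zero => exact funext fun i => i.elim0
  | succ k ih =>
    funext i
    induction i using Fin.cases with
    | zero => rfl
    | succ i => exact congrFun (ih fun i => f i.succ) i

@[simp]
theorem tupleCode_decodeTuple {k : ℕ} (x : Carrier (tupleTy σ k)) :
    tupleCode (decodeTuple k x) = x := by
  induction k with
  | zero => rfl
  | succ k ih => exact Prod.ext rfl (ih (x : El σ × El (tupleTy σ k)).2)

@[simp]
theorem decodeSubst_encodeSubst {k : ℕ} (η : Subst (Carrier σ) k k) :
    decodeSubst (encodeSubst η) = η := by
  funext i
  rw [decodeSubst, encodeSubst, decodeTuple_tupleCode]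
  change List.map (decodeLetter k) (List.map (letterCode k) (η i)) = η i
  simp [Function.comp_def]

-- Every element of the type codes a substitution over all of Σ, so membership in the universe can
-- be tested after decoding.
@[simp]
theorem encodeSubst_decodeSubst {k : ℕ} (x : Carrier (updateTy σ k)) :
    encodeSubst (decodeSubst x) = x := by
  refine Eq.trans (congrArg tupleCode (funext fun i => ?_)) (tupleCode_decodeTuple x)
  simp only [decodeSubst, List.map_map, Function.comp_def, letterCode_decodeLetter, List.map_id']
  rfl

namespace FO

@[fun_prop]
theorem decodeLetter (k : ℕ) :
    FO (decodeLetter k : Carrier (letterTy σ k) → Carrier σ ⊕ Fin k) := by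
  induction k with
  | zero => exact inl
  | succ k ih =>
    have h : FO fun x : Carrier (letterTy σ (k + 1)) =>
        (show Unit ⊕ Carrier (letterTy σ k) from x) :=
      ⟨_, .id _, fun x => by cases (show Unit ⊕ Carrier (letterTy σ k) from x) <;> rfl⟩
    have h' : FO fun i : Fin k => i.succ := ofFin _
    exact sumElim (f := fun _ (_ : Unit) => Sum.inr 0)
      (g := fun _ y => Sum.elim Sum.inl (fun i => Sum.inr i.succ) (_root_.decodeLetter k y))
      (by fun_prop) (by fun_prop) h

@[fun_prop]
theorem letterCode (k : ℕ) : FO (letterCode k : Carrier σ ⊕ Fin k → Carrier (letterTy σ k)) := by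
  have h : FO (elemCode k : Carrier σ → Carrier (letterTy σ k)) := by
    induction k with
    | zero => exact id
    | succ k ih => exact fo_iff_isFOList.2 ((fo_iff_isFOList.1 ih).comp (.coproj₂ .one _))
  have h' : FO (regCode σ k) := ofFin _
  unfold _root_.letterCode
  fun_prop

@[fun_prop]
theorem decodeSubst {k : ℕ} :
    FO (decodeSubst : Carrier (updateTy σ k) → Subst (Carrier σ) k k) := by
  have h : FO (decodeTuple k : Carrier (updateTy σ k) → Fin k → Carrier (.list (letterTy σ k))) :=
    -- Tuples are coded in the same type `tupleTy`, so the identity realizes decoding.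
    ⟨_, .id _, fun x => (tupleCode_decodeTuple x).symm⟩
  unfold _root_.decodeSubst
  fun_prop

@[fun_prop]
theorem encodeSubst {k : ℕ} :
    FO (encodeSubst : Subst (Carrier σ) k k → Carrier (updateTy σ k)) := by
  have h : FO (tupleCode : (Fin k → Carrier (.list (letterTy σ k))) → Carrier (updateTy σ k)) :=
    ⟨_, .id _, fun x => rfl⟩
  unfold _root_.encodeSubst
  fun_prop

end FO

end Carrier

/-! ### The monoid of register updates -/

section RegMon

/-- By transitivity consecutive elements suffice, which makes monotonicity a first-order test. -/
theorem pairwise_iff_adjacentPairs {k : ℕ} (l : List (Fin k)) :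
    l.Pairwise (· < ·) ↔ ((adjacentPairs l).all fun p => decide (p.1 < p.2)) = true := by
  rw [← List.isChain_iff_pairwise]
  induction l with
  | nil => simp [adjacentPairs]
  | cons x l ih => cases l <;> simp_all [adjacentPairs]

theorem RegUpdate.monotone_iff {A : Type} {k : ℕ} (η : RegUpdate A k) :
    η.Monotone ↔ Subst.Monotone η := by
  rw [RegUpdate.Monotone, RegUpdate.registers_eq, List.pairwise_flatMap]
  refine and_congr (by simp [names]) ⟨fun h i j hij => ?_, fun h => ?_⟩
  · simpa [names] using List.pairwise_iff_getElem.1 h i j (by simp) (by simp) hij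
  · exact (List.pairwise_lt_finRange k).imp fun {i j} hij => h i j hij

theorem FO.flatMap_finite {α β ι : Type} [Coded α] [Coded β] {f : ι → α → List β}
    (hf : ∀ i, FO (f i)) (L : List ι) : FO fun x => L.flatMap fun i => f i x := by
  induction L with
  | nil => exact const []
  | cons i L ih =>
    have := hf i
    simp only [List.flatMap_cons]
    fun_prop

variable {σ : ListTy} {M : Set (El σ)} {k : ℕ}

/-- A letter over `M` as a letter over `Σ`. -/
def inclLetter : M ⊕ Fin k → Carrier σ ⊕ Fin k := Sum.map (fun m => (m : El σ)) id

/-- A register update over `M`, as a substitution over `Σ`. -/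
def RegUpdate.incl (η : RegUpdate M k) : Subst (Carrier σ) k k := fun i => (η i).map inclLetter

theorem names_incl (η : RegUpdate M k) (i : Fin k) : names (η.incl i) = names (η i) := by
  rw [RegUpdate.incl]
  induction η i with
  | nil => rfl
  | cons x w ih => rcases x with m | j; exacts [ih, congrArg (j :: ·) ih]

theorem monotone_incl_iff (η : RegUpdate M k) : η.incl.Monotone ↔ η.Monotone := by
  simp only [RegUpdate.monotone_iff, Subst.Monotone, names_incl]

theorem incl_mul (η θ : RegUpdate M k) : (η.mul θ).incl = η.incl.comp θ.incl := by
  funext i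
  simp only [RegUpdate.incl, RegUpdate.mul, Subst.comp, List.map_flatMap, List.flatMap_map]
  congr 1
  funext x
  cases x <;> rfl

theorem map_encodeLetter (w : List (M ⊕ Fin k)) :
    w.map (encodeLetter M k) = (w.map inclLetter).map (letterCode k) := by
  rw [List.map_map]
  refine List.map_congr_left fun x _ => ?_
  cases x <;> rfl

theorem encodeUpdate_eq (η : RegMon M k) :
    encodeUpdate M k η = encodeSubst (RegUpdate.incl η.1) :=
  congrArg (encodeTuple k) (funext fun i => map_encodeLetter (η.1 i))

theorem decodeSubst_encodeUpdate (η : RegMon M k) :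
    decodeSubst (encodeUpdate M k η) = RegUpdate.incl η.1 :=
  (congrArg decodeSubst (encodeUpdate_eq η)).trans (decodeSubst_encodeSubst _)

/-- Nonduplication needs no test of its own, as it follows from monotonicity; the condition on
letters lifts the words from Σ to `M`. -/
theorem mem_regMonSet_iff (x : El (updateTy σ k)) :
    x ∈ regMonSet M k ↔ RegUpdate.Monotone (decodeSubst x) ∧
      ∀ y ∈ (List.finRange k).flatMap (decodeSubst x), ∀ a : El σ, y = Sum.inl a → a ∈ M := by
  constructor
  · rintro ⟨η, rfl⟩
    rw [decodeSubst_encodeUpdate]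
    refine ⟨(RegUpdate.monotone_iff _).2 ((monotone_incl_iff _).2 η.2.2), fun y hy a ha => ?_⟩
    obtain ⟨i, _, hy⟩ := List.mem_flatMap.1 hy
    obtain ⟨m | j, _, rfl⟩ := List.mem_map.1 hy
    · exact Sum.inl_injective ha ▸ m.2
    · exact absurd ha Sum.inr_ne_inl
  · rintro ⟨hm, hM⟩
    have : ∀ i, ∃ w : List (M ⊕ Fin k), w.map inclLetter = decodeSubst x i := by
      intro i
      change _ ∈ Set.range (List.map _)
      rw [Set.range_list_map]
      rintro (a | j) hy
      · exact ⟨Sum.inl ⟨a, hM _ (List.mem_flatMap.2 ⟨i, List.mem_finRange i, hy⟩) a rfl⟩, rfl⟩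
      · exact ⟨Sum.inr j, rfl⟩
    choose η hη using this
    have hη : RegUpdate.incl η = decodeSubst x := funext hη
    rw [RegUpdate.monotone_iff, ← hη, monotone_incl_iff] at hm
    exact ⟨⟨η, hm.nonduplicating, hm⟩, (encodeUpdate_eq _).trans
      ((congrArg encodeSubst hη).trans (encodeSubst_decodeSubst x))⟩

theorem isFODefinable_regMonSet (hM : IsFODefinable M) (k : ℕ) :
    IsFODefinable (regMonSet M k) := by
  obtain ⟨p, hp, h⟩ := isFODefinable_iff.1 hM
  have hlt : FO fun q : Fin k × Fin k => decide (q.1 < q.2) :=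
    FO.finCases (f := fun q j => decide (q.1 < j))
      (fun j => (FO.ofFin fun i => decide (i < j)).comp FO.fst) FO.snd
  have hw : FO fun x : Carrier (updateTy σ k) => (List.finRange k).flatMap (decodeSubst x) :=
    FO.flatMap_finite (f := fun i x => decodeSubst x i) (fun i => by fun_prop) _
  refine isFODefinable_iff.2 ⟨fun x =>
    ((adjacentPairs (names ((List.finRange k).flatMap (decodeSubst x)))).all
      fun q => decide (q.1 < q.2)) &&
    ((List.finRange k).flatMap (decodeSubst x)).all (Sum.elim p fun _ => true),
    by fun_prop, fun x => ?_⟩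
  rw [mem_regMonSet_iff, Bool.and_eq_true, ← pairwise_iff_adjacentPairs, List.all_eq_true]
  refine and_congr Iff.rfl (forall₂_congr fun y _ => ?_)
  rcases y with a | j
  · exact ⟨fun hy => (h a).1 (hy a rfl), fun hy b hb => Sum.inl_injective hb ▸ (h a).2 hy⟩
  · exact ⟨fun _ => rfl, fun _ b hb => absurd hb Sum.inr_ne_inl⟩

/-- The coding of register updates, as an equivalence. -/
noncomputable def regMonEquiv (M : Set (El σ)) (k : ℕ) : RegMon M k ≃ regMonSet M k :=
  Equiv.ofInjective (encodeUpdate M k) (encodeUpdate_injective M k)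

theorem regMonEquiv_mul (η θ : RegMon M k) :
    regMonEquiv M k (η * θ) = regMonEquiv M k η * regMonEquiv M k θ := by
  conv_lhs => rw [← (regMonEquiv M k).symm_apply_apply η, ← (regMonEquiv M k).symm_apply_apply θ]
  rfl

theorem coe_regMonEquiv (η : RegMon M k) :
    (regMonEquiv M k η : El (updateTy σ k)) = encodeUpdate M k η := rfl

theorem coe_mul_regMonSet (x y : regMonSet M k) :
    ((x * y : regMonSet M k) : El (updateTy σ k)) =
      encodeSubst ((decodeSubst (x : El (updateTy σ k))).comp
        (decodeSubst (y : El (updateTy σ k)))) := by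
  obtain ⟨η, rfl⟩ := (regMonEquiv M k).surjective x
  obtain ⟨θ, rfl⟩ := (regMonEquiv M k).surjective y
  rw [← regMonEquiv_mul, coe_regMonEquiv, coe_regMonEquiv, coe_regMonEquiv,
    decodeSubst_encodeUpdate, decodeSubst_encodeUpdate, ← incl_mul]
  exact encodeUpdate_eq _

theorem coe_one_regMonSet :
    ((1 : regMonSet M k) : El (updateTy σ k)) = encodeSubst Subst.one := by
  exact encodeUpdate_eq 1

theorem coe_prod_regMonSet (l : List (El (updateTy σ k))) (h : ∀ x ∈ l, x ∈ regMonSet M k) :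
    ((l.attachWith (· ∈ regMonSet M k) h).prod : El (updateTy σ k)) =
      encodeSubst (Subst.prod (l.map decodeSubst)) := by
  induction l with
  | nil => exact coe_one_regMonSet
  | cons x l ih =>
    rw [List.attachWith_cons, List.prod_cons, coe_mul_regMonSet,
      ih fun y hy => h y (List.mem_cons_of_mem _ hy), decodeSubst_encodeSubst]
    rfl

end RegMon

theorem theorem5p1 (σ : ListTy) (M : Set (El σ)) [Monoid M] (hM : IsFOListMonoid M) (k : ℕ) :
    IsFOListMonoid (regMonSet M k) := by
  have hdef := isFODefinable_regMonSet hM.1 k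
  have hprod : FO fun l : List (Carrier (updateTy σ k)) =>
      encodeSubst (Subst.prodFO k (l.map decodeSubst)) := by
    have := FO.prodFO (A := Carrier σ) k
    fun_prop
  refine ⟨hdef, hdef.listsOver, hdef, _, hprod.isFOList_list, fun l => ?_⟩
  -- The realizer is defined on all lists, but `Subst.prodFO_eq` requires monotone entries;
  -- membership in the universe supplies this.
  have hl : ∀ η ∈ (l.1 : List (Carrier (updateTy σ k))).map decodeSubst, η.Monotone := by
    intro η hη
    obtain ⟨x, hx, rfl⟩ := List.mem_map.1 hη
    exact (RegUpdate.monotone_iff _).1 ((mem_regMonSet_iff x).1 (l.2 x hx)).1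
  rw [Subst.prodFO_eq hl]
  exact (coe_prod_regMonSet l.1 l.2).symm
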